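/- Let $P=(X,\prec)$ be a finite poset with $|X|=n$. A linear extension of $P$ is a bijection $f:X\to\{1,\dots,n\}$ such that $x\prec y$ implies $f(x)<f(y)$; let $\mathbb{E}$ denote the expectation over a uniformly random linear extension $f$ of $P$. Then for every element $x\in X$, $$1\;\le\;\frac{\mathbb{E}[f(x)^2]}{\mathbb{E}[f(x)]^2}\;<\;2 .$$ Moreover, the upper bound is asymptotically tight: for every $\varepsilon>0$ there is an $N$ such that for every $n\ge N$ there exist a poset $P=(X,\prec)$ with $|X|=n$ and an element $x\in X$ with $$\frac{\mathbb{E}[f(x)^2]}{\mathbb{E}[f(x)]^2}\;>\;2-\varepsilon .$$ -/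

import Mathlib

/-- A linear extension of a finite poset `X` with `n` elements: a bijection from `X` onto an
`n`-element chain such that `x < y` implies `f x < f y`. The chain is `Fin n = {0, …, n - 1}`
here; `PosetLinExt.val` below shifts the values to `{1, …, n}`. -/
def PosetLinExt (X : Type*) [Fintype X] [PartialOrder X] : Type _ :=
  {f : X ≃ Fin (Fintype.card X) // StrictMono f}

namespace PosetLinExt

noncomputable instance (X : Type*) [Fintype X] [PartialOrder X] : Fintype (PosetLinExt X) := by
  classical
  unfold PosetLinExt
  infer_instance

/-- The value `f(x) ∈ {1, …, n}` of the linear extension `f` at `x`, as a real number. -/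
def val {X : Type*} [Fintype X] [PartialOrder X] (f : PosetLinExt X) (x : X) : ℝ :=
  ((f.1 x : ℕ) : ℝ) + 1

/-- The expectation of the random variable `Z` on the set of linear extensions of `X`,
with respect to the uniform distribution. -/
noncomputable def expect {X : Type*} [Fintype X] [PartialOrder X] (Z : PosetLinExt X → ℝ) : ℝ :=
  (∑ f : PosetLinExt X, Z f) / (Fintype.card (PosetLinExt X) : ℝ)

end PosetLinExt

/-- The ratio `E[f(x)²] / E[f(x)]²` for a uniform random linear extension `f` of `X`. -/
noncomputable def secondMomentRatio {X : Type*} [Fintype X] [PartialOrder X] (x : X) : ℝ :=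
  PosetLinExt.expect (fun f : PosetLinExt X => f.val x ^ 2) /
    PosetLinExt.expect (fun f : PosetLinExt X => f.val x) ^ 2

open Finset

/-! The lower bound is Cauchy–Schwarz. For the upper bound, replace linear extensions by strictly
monotone maps `g : X → {0, …, m - 1}` and let `N k` count those with `g x ≥ k`. Daykin's inequality
gives `N 0 * N (k + i) ≤ N k * N i` (`card_strictMaps_mul_le`): the tail is "new better than used",
like a discrete variable lighter-tailed than the geometric one. Summing over `k` and `i` bounds the
second moment of `g x` by twice the square of the first.

An injective `g` is a linear extension followed by an embedding of chains, and non-injective maps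
are negligible as `m → ∞`. The limit, `moment_ineq`, reads `(n + 1) E[f² + f] ≤ 2 (n + 2) E[f]²`.
This gives the bound 2 when `E[f] ≤ n / 2`; otherwise `f ≤ n` suffices.

For tightness, `x` is the bottom of a long chain beside a far longer disjoint one; `f x` is then
nearly exponential. -/

/-! ### Moments of order embeddings between finite chains. -/

theorem orderEmb_fin_ext {n : ℕ} {α : Type*} [LinearOrder α] {e e' : Fin n ↪o α}
    (h : Set.range e = Set.range e') : e = e' :=
  DFunLike.coe_injective ((StrictMono.range_inj e.strictMono e'.strictMono).1 h)

theorem card_orderEmb_fin (n m : ℕ) : Fintype.card (Fin n ↪o Fin m) = m.choose n := by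
  have key : #(univ : Finset (Fin n ↪o Fin m)) = #(powersetCard n (univ : Finset (Fin m))) := by
    refine card_bij (fun e _ => univ.map e.toEmbedding) (by simp) (fun e _ e' _ h => ?_) ?_
    · apply orderEmb_fin_ext
      have h' := congrArg (fun s : Finset (Fin m) => (s : Set (Fin m))) h
      simp only [coe_map, coe_univ, Set.image_univ] at h'
      exact h'
    · intro s hs
      rw [mem_powersetCard] at hs
      exact ⟨s.orderEmbOfFin hs.2, mem_univ _, s.map_orderEmbOfFin_univ hs.2⟩
  rwa [card_univ, card_powersetCard, card_univ, Fintype.card_fin] at key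

/-- Deleting the value at `i` from an order embedding and closing the gap in the codomain. -/
theorem exists_deletion {n m : ℕ} (e : Fin (n + 1) ↪o Fin (m + 1)) (i : Fin (n + 1)) :
    ∃ d : Fin n ↪o Fin m, ∀ k, (e i).succAbove (d k) = e (i.succAbove k) := by
  have h : ∀ k, ∃ y, (e i).succAbove y = e (i.succAbove k) := fun k =>
    Fin.exists_succAbove_eq (fun h => Fin.succAbove_ne i k (e.injective h))
  choose d hd using h
  refine ⟨OrderEmbedding.ofStrictMono d fun a b hab => ?_, hd⟩
  rw [← Fin.succAbove_lt_succAbove_iff (p := e i), hd, hd]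
  exact e.strictMono (Fin.succAbove_lt_succAbove_iff.2 hab)

noncomputable def deletion {n m : ℕ} (e : Fin (n + 1) ↪o Fin (m + 1)) (i : Fin (n + 1)) :
    Fin n ↪o Fin m := (exists_deletion e i).choose

theorem deletion_spec {n m : ℕ} (e : Fin (n + 1) ↪o Fin (m + 1)) (i : Fin (n + 1)) (k : Fin n) :
    (e i).succAbove (deletion e i k) = e (i.succAbove k) := (exists_deletion e i).choose_spec k

theorem range_eq_insert_deletion {n m : ℕ} (e : Fin (n + 1) ↪o Fin (m + 1)) (i : Fin (n + 1)) :
    Set.range e = insert (e i) (Set.range ((e i).succAbove ∘ deletion e i)) := by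
  have : (e i).succAbove ∘ deletion e i = e ∘ i.succAbove := funext (deletion_spec e i)
  rw [this, Set.range_comp, Fin.range_succAbove, ← Set.image_insert_eq]
  rw [show insert i ({i}ᶜ : Set (Fin (n + 1))) = Set.univ by ext; simp [em], Set.image_univ]

/-- Deleting a point while remembering its value loses nothing. The cardinalities agree by `(n + 1)
* C(m + 1, n + 1) = (m + 1) * C(m, n)`, so injectivity is enough. -/
theorem deletion_bijective (n m : ℕ) :
    Function.Bijective fun p : (Fin (n + 1) ↪o Fin (m + 1)) × Fin (n + 1) =>
      (deletion p.1 p.2, p.1 p.2) := by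
  rw [Fintype.bijective_iff_injective_and_card]
  constructor
  · rintro ⟨e, i⟩ ⟨e', i'⟩ h
    simp only [Prod.mk.injEq] at h
    obtain ⟨h₁, h₂⟩ := h
    have : e = e' := orderEmb_fin_ext <| by
      rw [range_eq_insert_deletion e i, range_eq_insert_deletion e' i', h₁, h₂]
    subst this
    rw [e.injective h₂]
  · simp only [Fintype.card_prod, card_orderEmb_fin, Fintype.card_fin]
    rw [← Nat.add_one_mul_choose_eq, mul_comm]

/-- Double counting: `e j + 1` is the number of slots for a new point below `e j`. After insertion
that value is raised by one and sits at index `j + 1`, while the new point has one of the `j + 1`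
indices below it. The weight `w` lets the identity be iterated for the second moment. -/
theorem sum_orderEmb_succ_mul {n m : ℕ} (j : Fin n) (w : ℕ → ℕ) :
    ∑ e : Fin n ↪o Fin m, ((e j : ℕ) + 1) * w (e j + 1) =
      (j + 1) * ∑ e : Fin (n + 1) ↪o Fin (m + 1), w (e j.succ) := by
  have hcard : ∀ {l : ℕ} (a : Fin l), #{z : Fin (l + 1) | z ≤ a.castSucc} = a + 1 := by
    intro l a
    rw [show (univ.filter fun z : Fin (l + 1) => z ≤ a.castSucc) = Iic a.castSucc by ext; simp]
    simp
  calc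
    _ = ∑ e : Fin n ↪o Fin m, ∑ z : Fin (m + 1),
          if z ≤ (e j).castSucc then w (e j + 1) else 0 := by
      refine sum_congr rfl fun e _ => ?_
      rw [← sum_filter, sum_const, hcard, smul_eq_mul]
    _ = ∑ p : (Fin n ↪o Fin m) × Fin (m + 1),
          if p.2 ≤ (p.1 j).castSucc then w (p.1 j + 1) else 0 := by
      rw [Fintype.sum_prod_type]
    _ = ∑ p : (Fin (n + 1) ↪o Fin (m + 1)) × Fin (n + 1),
          if p.2 ≤ j.castSucc then w (p.1 j.succ) else 0 := by
      symm
      refine Fintype.sum_bijective _ (deletion_bijective n m) _ _ ?_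
      rintro ⟨e, i⟩
      have hs := deletion_spec e i j
      have hiff : e i ≤ (deletion e i j).castSucc ↔ i ≤ j.castSucc := by
        rw [← Fin.lt_succAbove_iff_le_castSucc, hs, e.lt_iff_lt, Fin.lt_succAbove_iff_le_castSucc]
      by_cases h : i ≤ j.castSucc
      · rw [Fin.succAbove_of_le_castSucc _ _ h, Fin.succAbove_of_le_castSucc _ _ (hiff.2 h)] at hs
        simp [h, hiff, ← hs]
      · simp [h, hiff]
    _ = ∑ e : Fin (n + 1) ↪o Fin (m + 1), ∑ i : Fin (n + 1),
          if i ≤ j.castSucc then w (e j.succ) else 0 := by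
      rw [Fintype.sum_prod_type]
    _ = _ := by
      rw [mul_sum]
      refine sum_congr rfl fun e _ => ?_
      rw [← sum_filter, sum_const, hcard, smul_eq_mul]

theorem sum_orderEmb_succ {n m : ℕ} (j : Fin n) :
    ∑ e : Fin n ↪o Fin m, ((e j : ℕ) + 1) = (j + 1) * (m + 1).choose (n + 1) := by
  have := sum_orderEmb_succ_mul (m := m) j fun _ => 1
  simpa [card_orderEmb_fin] using this

theorem sum_orderEmb_succ_mul_succ {n m : ℕ} (j : Fin n) :
    ∑ e : Fin n ↪o Fin m, ((e j : ℕ) + 1) * (e j + 2) =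
      (j + 1) * (j + 2) * (m + 2).choose (n + 2) := by
  have := sum_orderEmb_succ_mul (m := m) j fun t => t + 1
  rw [sum_orderEmb_succ, Fin.val_succ, ← mul_assoc] at this
  exact this

/-! ### The tail inequality for strictly monotone maps. -/

/-- Strictly monotone maps from `X` to `{0, …, m - 1}` with value at least `k` at `x`. -/
noncomputable def strictMaps {X : Type*} [Fintype X] [PartialOrder X] (x : X) (m k : ℕ) :
    Finset (X → ℕ) := by
  classical
  exact {g ∈ Fintype.piFinset fun _ : X => range m | StrictMono g ∧ k ≤ g x}

section
variable {X : Type*} [Fintype X] [PartialOrder X] {x : X} {m : ℕ}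

theorem mem_strictMaps {k : ℕ} {g : X → ℕ} :
    g ∈ strictMaps x m k ↔ (∀ y, g y < m) ∧ StrictMono g ∧ k ≤ g x := by
  simp [strictMaps]

theorem card_strictMaps_mul_le (k i : ℕ) :
    #(strictMaps x m 0) * #(strictMaps x m (k + i)) ≤
      #(strictMaps x m k) * #(strictMaps x m i) := by
  classical
  have hinj : Function.Injective fun (g : X → ℕ) y => g y + k := fun g h e =>
    funext fun y => by simpa using congrFun e y
  -- Both families on which `x` is only weakly constrained are shifted up by `k`. Meets with the
  -- unshifted family stay below `m`, and joins are shifts by `k`, so Daykin's inequality in the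
  -- lattice `X → ℕ` applies.
  rw [← card_image_of_injective (strictMaps x m 0) hinj,
    ← card_image_of_injective (strictMaps x m i) hinj]
  refine (le_card_infs_mul_card_sups _ _).trans (Nat.mul_le_mul (card_le_card ?_) (card_le_card ?_))
  · intro h hh
    obtain ⟨f', hf', g, hg, rfl⟩ := mem_infs.1 hh
    obtain ⟨f, hf, rfl⟩ := mem_image.1 hf'
    rw [mem_strictMaps] at *
    refine ⟨fun y => inf_lt_of_right_lt (hg.1 y), fun y z hyz => ?_, ?_⟩
    · have h₁ := hf.2.1 hyz
      have h₂ := hg.2.1 hyz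
      simp only [Pi.inf_apply]
      omega
    · simp only [Pi.inf_apply]
      omega
  · intro h hh
    obtain ⟨f', hf', g, hg, rfl⟩ := mem_sups.1 hh
    obtain ⟨f, hf, rfl⟩ := mem_image.1 hf'
    rw [mem_strictMaps] at hf hg
    -- The join shifted back down. Where `g y < k` the truncated difference is 0, and strictness
    -- comes from `f`.
    refine mem_image.2 ⟨fun y => max (f y) (g y - k), mem_strictMaps.2 ⟨fun y => ?_,
      fun y z hyz => ?_, ?_⟩, funext fun y => ?_⟩
    · have h₁ := hf.1 y
      have h₂ := hg.1 y
      omega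
    · have h₁ := hf.2.1 hyz
      have h₂ := hg.2.1 hyz
      beta_reduce
      omega
    · omega
    · simp only [Pi.sup_apply]
      omega

theorem card_strictMaps_eq_sum (k : ℕ) :
    #(strictMaps x m k) = ∑ g ∈ strictMaps x m 0, if k ≤ g x then 1 else 0 := by
  rw [← card_filter]
  congr 1
  ext g
  simp [mem_strictMaps, and_assoc]

theorem card_range_filter_le {m t : ℕ} (k : ℕ) (h : t < m) :
    (∑ i ∈ range m, if k + i ≤ t then 1 else 0) = t + 1 - k := by
  rw [← card_filter, show (range m).filter (fun i => k + i ≤ t) = range (t + 1 - k) by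
    ext i; simp only [mem_filter, mem_range]; omega, card_range]

theorem sum_range_sub_mul_two {m t : ℕ} (h : t < m) :
    (∑ k ∈ range m, (t + 1 - k)) * 2 = (t + 1) * (t + 2) := by
  rw [← sum_subset (range_subset_range.2 (Nat.succ_le_of_lt h))
    (fun k _ hk => by simp only [mem_range] at hk; omega)]
  rw [← sum_range_reflect]
  rw [sum_congr rfl (g := fun k => k + 1) (fun k hk => by simp only [mem_range] at hk; omega)]
  clear h
  induction t with
  | zero => simp
  | succ t ih => rw [sum_range_succ, add_mul, ih]; ring

/-- Layer-cake formulas: tails sum to `g x + 1`, and tails at `k + i` over all pairs sum to `(g x +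
1) * (g x + 2) / 2`. The tail inequality then compares the double sum with a product of single sums.
-/
theorem card_mul_sum_strictMaps_le :
    #(strictMaps x m 0) * ∑ g ∈ strictMaps x m 0, (g x + 1) * (g x + 2) ≤
      2 * (∑ g ∈ strictMaps x m 0, (g x + 1)) ^ 2 := by
  have h₁ : ∑ g ∈ strictMaps x m 0, (g x + 1) = ∑ k ∈ range m, #(strictMaps x m k) := by
    simp_rw [card_strictMaps_eq_sum (x := x) (m := m)]
    rw [sum_comm]
    refine sum_congr rfl fun g hg => ?_
    have := card_range_filter_le 0 ((mem_strictMaps.1 hg).1 x)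
    simpa using this.symm
  have h₂ : ∑ g ∈ strictMaps x m 0, (g x + 1) * (g x + 2) =
      (∑ k ∈ range m, ∑ i ∈ range m, #(strictMaps x m (k + i))) * 2 := by
    simp_rw [card_strictMaps_eq_sum (x := x) (m := m) (_ + _)]
    rw [sum_congr rfl fun k _ => sum_comm, sum_comm, sum_mul]
    refine sum_congr rfl fun g hg => ?_
    have hlt := (mem_strictMaps.1 hg).1 x
    rw [sum_congr rfl fun k _ => card_range_filter_le k hlt, sum_range_sub_mul_two hlt]
  rw [h₁, h₂, sq, sum_mul_sum, ← mul_assoc, mul_comm _ 2, mul_sum]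
  refine Nat.mul_le_mul_left _ (sum_le_sum fun k _ => ?_)
  rw [mul_sum]
  exact sum_le_sum fun i _ => card_strictMaps_mul_le k i

end

/-! ### From strictly monotone maps to linear extensions. -/

namespace PosetLinExt
variable {X : Type*} [Fintype X] [PartialOrder X]

instance : Nonempty (PosetLinExt X) := by
  classical
  let _ : Fintype (LinearExtension X) := inferInstanceAs (Fintype X)
  have e := (Fintype.orderIsoFinOfCardEq (LinearExtension X) (k := Fintype.card X) rfl).symm
  have ht : StrictMono (toLinearExtension : X →o LinearExtension X) :=
    toLinearExtension.monotone.strictMono_of_injective fun _ _ h => h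
  exact ⟨⟨(Equiv.refl X).trans e.toEquiv, e.strictMono.comp ht⟩⟩

theorem compMap_injective (m : ℕ) :
    Function.Injective fun (p : PosetLinExt X × (Fin (Fintype.card X) ↪o Fin m)) (y : X) =>
      (p.2 (p.1.1 y) : ℕ) := by
  rintro ⟨f, e⟩ ⟨f', e'⟩ h
  have h' : ∀ y, e (f.1 y) = e' (f'.1 y) := fun y => Fin.ext (congrFun h y)
  have he : e = e' := by
    apply orderEmb_fin_ext
    rw [← f.1.surjective.range_comp, ← f'.1.surjective.range_comp]
    exact congrArg Set.range (funext h')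
  subst he
  rw [Subtype.ext (Equiv.ext fun y => e.injective (h' y)) (a1 := f) (a2 := f')]

theorem exists_eq_comp {m : ℕ} {g : X → Fin m} (hg : StrictMono g) (hinj : Function.Injective g) :
    ∃ (f : PosetLinExt X) (e : Fin (Fintype.card X) ↪o Fin m), ∀ y, e (f.1 y) = g y := by
  classical
  have hs : #(univ.image g) = Fintype.card X := by
    rw [card_image_of_injective _ hinj, card_univ]
  have hmem : ∀ y, g y ∈ univ.image g := fun y => mem_image_of_mem g (mem_univ y)
  let F : X → Fin (Fintype.card X) := fun y => ((univ.image g).orderIsoOfFin hs).symm ⟨g y, hmem y⟩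
  have hF : Function.Injective F := fun y z h =>
    hinj (Subtype.ext_iff.1 (((univ.image g).orderIsoOfFin hs).symm.injective h))
  refine ⟨⟨Equiv.ofBijective F
    ((Fintype.bijective_iff_injective_and_card F).2 ⟨hF, by simp⟩), fun y z h => ?_⟩,
    (univ.image g).orderEmbOfFin hs, fun y => ?_⟩
  · exact ((univ.image g).orderIsoOfFin hs).symm.strictMono (hg h)
  · rw [← coe_orderIsoOfFin_apply]
    simp [F]

theorem sum_injective_strictMaps [DecidablePred fun g : X → ℕ => Function.Injective g]
    (x : X) (m : ℕ) (h : ℕ → ℕ) :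
    ∑ g ∈ strictMaps x m 0 with Function.Injective g, h (g x) =
      ∑ f : PosetLinExt X, ∑ e : Fin (Fintype.card X) ↪o Fin m, h (e (f.1 x)) := by
  rw [← Fintype.sum_prod_type']
  symm
  refine sum_bij (fun p _ y => (p.2 (p.1.1 y) : ℕ)) ?_ (fun p _ q _ h => compMap_injective m h) ?_
    (fun _ _ => rfl)
  · rintro ⟨f, e⟩ -
    rw [mem_filter, mem_strictMaps]
    exact ⟨⟨fun y => Fin.is_lt _, fun y z h => e.strictMono (f.2 h), Nat.zero_le _⟩,
      fun y z h => f.1.injective (e.injective (Fin.ext h))⟩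
  · intro g hg
    rw [mem_filter, mem_strictMaps] at hg
    obtain ⟨f, e, hfe⟩ := exists_eq_comp (g := fun y => (⟨g y, hg.1.1 y⟩ : Fin m))
      (fun y z h => hg.1.2.1 h) (fun y z h => hg.2 (Fin.ext_iff.1 h))
    exact ⟨(f, e), mem_univ _, funext fun y => congrArg Fin.val (hfe y)⟩

theorem card_mul_choose_le (x : X) (m : ℕ) :
    Fintype.card (PosetLinExt X) * m.choose (Fintype.card X) ≤ #(strictMaps x m 0) := by
  classical
  have := sum_injective_strictMaps x m fun _ => 1
  simp only [sum_const, card_univ, card_orderEmb_fin, smul_eq_mul, mul_one] at this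
  rw [← this]
  exact card_le_card (filter_subset _ _)

theorem sum_mul_choose_le (x : X) (m : ℕ) :
    (∑ f : PosetLinExt X, ((f.1 x : ℕ) + 1) * (f.1 x + 2)) *
        (m + 2).choose (Fintype.card X + 2) ≤
      ∑ g ∈ strictMaps x m 0, (g x + 1) * (g x + 2) := by
  classical
  have := sum_injective_strictMaps x m fun t => (t + 1) * (t + 2)
  simp only [sum_orderEmb_succ_mul_succ, ← sum_mul] at this
  rw [← this]
  exact sum_le_sum_of_subset (filter_subset _ _)

/-- Monotonicity is dropped here: counting all non-injective maps already gives `o(m ^ n)`, where `n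
= |X|`. -/
theorem card_not_injective_le [DecidablePred fun g : X → ℕ => Function.Injective g]
    (x : X) (m : ℕ) :
    #{g ∈ strictMaps x m 0 | ¬ Function.Injective g} + m.descFactorial (Fintype.card X) ≤
      m ^ Fintype.card X := by
  classical
  have h₁ : m ^ Fintype.card X = #(univ : Finset (X → Fin m)) := by simp
  have h₂ : m.descFactorial (Fintype.card X) =
      #{g : X → Fin m | Function.Injective g} := by
    rw [← Fintype.card_subtype, Fintype.card_congr (Equiv.subtypeInjectiveEquivEmbedding X (Fin m)),
      Fintype.card_embedding_eq, Fintype.card_fin]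
  rw [h₁, h₂, ← card_filter_add_card_filter_not (s := univ) fun g : X → Fin m => Function.Injective g,
    add_comm]
  refine Nat.add_le_add_left ?_ _
  refine card_le_card_of_surjOn (fun g y => (g y : ℕ)) fun g hg => ?_
  simp only [coe_filter, Set.mem_ofPred_eq, mem_strictMaps] at hg
  refine ⟨fun y => ⟨g y, hg.1.1 y⟩, ?_, rfl⟩
  simp only [coe_filter, mem_univ, true_and, Set.mem_ofPred_eq]
  exact fun h => hg.2 fun y z hyz => h (Fin.ext hyz)

theorem sum_strictMaps_le (x : X) (m : ℕ) :
    ∑ g ∈ strictMaps x m 0, (g x + 1) ≤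
      (∑ f : PosetLinExt X, ((f.1 x : ℕ) + 1)) * (m + 1).choose (Fintype.card X + 1) +
        m * (m ^ Fintype.card X - m.descFactorial (Fintype.card X)) := by
  classical
  have := sum_injective_strictMaps x m fun t => t + 1
  simp only [sum_orderEmb_succ, ← sum_mul] at this
  rw [← sum_filter_add_sum_filter_not _ fun g : X → ℕ => Function.Injective g, this]
  refine Nat.add_le_add_left ?_ _
  refine (sum_le_card_nsmul _ _ m fun g hg => ?_).trans ?_
  · rw [mem_filter, mem_strictMaps] at hg
    exact hg.1.1 x
  · rw [smul_eq_mul, mul_comm]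
    exact Nat.mul_le_mul_left _ (Nat.le_sub_of_add_le (card_not_injective_le x m))

theorem moment_ineq_choose (x : X) (m : ℕ) :
    (Fintype.card (PosetLinExt X) * m.choose (Fintype.card X)) *
        ((∑ f : PosetLinExt X, ((f.1 x : ℕ) + 1) * (f.1 x + 2)) *
          (m + 2).choose (Fintype.card X + 2)) ≤
      2 * ((∑ f : PosetLinExt X, ((f.1 x : ℕ) + 1)) * (m + 1).choose (Fintype.card X + 1) +
        m * (m ^ Fintype.card X - m.descFactorial (Fintype.card X))) ^ 2 :=
  (Nat.mul_le_mul (card_mul_choose_le x m) (sum_mul_choose_le x m)).trans <|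
    card_mul_sum_strictMaps_le.trans <|
      Nat.mul_le_mul_left _ (Nat.pow_le_pow_left (sum_strictMaps_le x m) 2)

/-! ### The limit of large codomain. -/

open Filter Topology

theorem tendsto_descFactorial_div_pow (k : ℕ) :
    Tendsto (fun m : ℕ => (m.descFactorial k : ℝ) / (m : ℝ) ^ k) atTop (𝓝 1) :=
  (Asymptotics.isEquivalent_iff_tendsto_one (by
    filter_upwards [eventually_gt_atTop 0] with m hm
    positivity)).1 (isEquivalent_descFactorial k)

theorem tendsto_choose_add_div_pow (k d : ℕ) :
    Tendsto (fun m : ℕ => ((m + d).choose k : ℝ) / (m : ℝ) ^ k) atTop (𝓝 (1 / k.factorial)) := by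
  have h₁ : Tendsto (fun m : ℕ => ((m + d : ℕ) : ℝ) / (m : ℝ)) atTop (𝓝 1) := by
    have := (tendsto_const_div_atTop_nhds_zero_nat (d : ℝ)).const_add 1
    rw [add_zero] at this
    refine this.congr' ?_
    filter_upwards [eventually_gt_atTop 0] with m hm
    push_cast
    field_simp
  have h₂ := (((tendsto_descFactorial_div_pow k).comp (tendsto_add_atTop_nat d)).mul
    (h₁.pow k)).div_const (k.factorial : ℝ)
  rw [one_pow, one_mul] at h₂
  refine h₂.congr' ?_
  filter_upwards [eventually_gt_atTop 0] with m hm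
  have : ((m + d : ℕ) : ℝ) ≠ 0 := by positivity
  rw [Nat.choose_eq_descFactorial_div_factorial,
    Nat.cast_div (Nat.factorial_dvd_descFactorial _ _) (by positivity)]
  simp only [Function.comp_apply, div_pow]
  field_simp

theorem moment_ineq (x : X) :
    (Fintype.card X + 1 : ℝ) * (Fintype.card (PosetLinExt X) *
        ∑ f : PosetLinExt X, (f.val x ^ 2 + f.val x)) ≤
      2 * (Fintype.card X + 2) * (∑ f : PosetLinExt X, f.val x) ^ 2 := by
  set n := Fintype.card X with hn
  set c : ℝ := ((Fintype.card (PosetLinExt X) : ℕ) : ℝ) with hc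
  set S : ℝ := ∑ f : PosetLinExt X, f.val x with hS
  set T : ℝ := ∑ f : PosetLinExt X, (f.val x ^ 2 + f.val x) with hT
  have hle : ∀ m : ℕ, 0 < m →
      (c * ((m.choose n : ℝ) / (m : ℝ) ^ n)) * (T * (((m + 2).choose (n + 2) : ℝ) / (m : ℝ) ^ (n + 2)))
      ≤ 2 * (S * (((m + 1).choose (n + 1) : ℝ) / (m : ℝ) ^ (n + 1)) +
          (1 - (m.descFactorial n : ℝ) / (m : ℝ) ^ n)) ^ 2 := by
    intro m hm
    have h := moment_ineq_choose x m
    have h' : ((c * m.choose n) * (T * (m + 2).choose (n + 2)) : ℝ) ≤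
        2 * (S * (m + 1).choose (n + 1) + m * ((m : ℝ) ^ n - m.descFactorial n)) ^ 2 := by
      have hTc : T = ((∑ f : PosetLinExt X, ((f.1 x : ℕ) + 1) * (f.1 x + 2) : ℕ) : ℝ) := by
        rw [hT, Nat.cast_sum]
        refine sum_congr rfl fun f _ => ?_
        rw [PosetLinExt.val]
        push_cast
        ring
      have hSc : S = ((∑ f : PosetLinExt X, ((f.1 x : ℕ) + 1) : ℕ) : ℝ) := by
        rw [hS, Nat.cast_sum]
        refine sum_congr rfl fun f _ => ?_
        rw [PosetLinExt.val]
        push_cast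
        ring
      have hsub : (m : ℝ) ^ n - m.descFactorial n = ((m ^ n - m.descFactorial n : ℕ) : ℝ) := by
        rw [Nat.cast_sub (Nat.descFactorial_le_pow m n), Nat.cast_pow]
      rw [hc, hTc, hSc, hsub]
      exact_mod_cast h
    have hm' : (0 : ℝ) < m := by positivity
    -- Both sides have total degree `2 * (n + 1)` in `m`; on the left it splits as `n + (n + 2)`.
    have hp : (0 : ℝ) < ((m : ℝ) ^ (n + 1)) ^ 2 := by positivity
    rw [← mul_le_mul_iff_left₀ hp]
    calc _ = ((c * m.choose n) * (T * (m + 2).choose (n + 2)) : ℝ) := by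
          field_simp
          ring
      _ ≤ _ := h'
      _ = _ := by
          field_simp
          ring
  have hlim₁ := ((tendsto_choose_add_div_pow n 0).const_mul c).mul
    ((tendsto_choose_add_div_pow (n + 2) 2).const_mul T)
  have hlim₂ := ((((tendsto_choose_add_div_pow (n + 1) 1).const_mul S).add
    ((tendsto_descFactorial_div_pow n).const_sub 1)).pow 2).const_mul 2
  have key := le_of_tendsto_of_tendsto hlim₁ hlim₂
    (by filter_upwards [eventually_gt_atTop 0] with m hm using hle m hm)
  rw [Nat.factorial_succ (n + 1), Nat.factorial_succ n] at key
  push_cast at key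
  have hf : (0 : ℝ) < n.factorial := by positivity
  -- A common denominator of `n! * (n + 2)!` and `(n + 1)! ^ 2`.
  have hq : (0 : ℝ) < (n + 1) ^ 2 * (n + 2) * (n.factorial : ℝ) ^ 2 := by positivity
  rw [← mul_le_mul_iff_left₀ hq] at key
  rw [show (n : ℝ) + 1 + 1 = n + 2 by ring, sub_self, add_zero] at key
  calc _ = _ := by field_simp
    _ ≤ _ := key
    _ = _ := by field_simp

end PosetLinExt

/-! ### The two bounds on the ratio. -/

namespace PosetLinExt
section
variable {X : Type*} [Fintype X] [PartialOrder X]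

theorem card_pos : (0 : ℝ) < Fintype.card (PosetLinExt X) :=
  Nat.cast_pos.2 Fintype.card_pos

theorem one_le_val (f : PosetLinExt X) (x : X) : 1 ≤ f.val x := by
  simp [val]

theorem val_le_card (f : PosetLinExt X) (x : X) : f.val x ≤ Fintype.card X := by
  have := (f.1 x).isLt
  rw [val]
  exact_mod_cast this

theorem sum_val_pos (x : X) : 0 < ∑ f : PosetLinExt X, f.val x :=
  sum_pos (fun f _ => zero_lt_one.trans_le (f.one_le_val x)) univ_nonempty

theorem secondMomentRatio_eq (x : X) :
    secondMomentRatio x = Fintype.card (PosetLinExt X) * (∑ f : PosetLinExt X, f.val x ^ 2) /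
      (∑ f : PosetLinExt X, f.val x) ^ 2 := by
  have h₁ := (card_pos (X := X)).ne'
  have h₂ := (sum_val_pos x).ne'
  rw [secondMomentRatio, expect, expect]
  field_simp

theorem one_le_secondMomentRatio (x : X) : 1 ≤ secondMomentRatio x := by
  rw [secondMomentRatio_eq, one_le_div (pow_pos (sum_val_pos x) 2)]
  exact sq_sum_le_card_mul_sum_sq

theorem secondMomentRatio_lt_two (x : X) : secondMomentRatio x < 2 := by
  rw [secondMomentRatio_eq, div_lt_iff₀ (pow_pos (sum_val_pos x) 2)]
  have hmom := moment_ineq x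
  have hS := sum_val_pos x
  have hc := card_pos (X := X)
  have hle : ∑ f : PosetLinExt X, f.val x ^ 2 ≤
      Fintype.card X * ∑ f : PosetLinExt X, f.val x := by
    rw [mul_sum]
    refine sum_le_sum fun f _ => ?_
    rw [sq]
    exact mul_le_mul_of_nonneg_right (f.val_le_card x) (zero_le_one.trans (f.one_le_val x))
  rw [sum_add_distrib] at hmom
  set c : ℝ := ((Fintype.card (PosetLinExt X) : ℕ) : ℝ)
  set n : ℝ := ((Fintype.card X : ℕ) : ℝ)
  set S := ∑ f : PosetLinExt X, f.val x
  set Q := ∑ f : PosetLinExt X, f.val x ^ 2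
  have hn : 0 ≤ n := Nat.cast_nonneg _
  -- The split is at mean `n / 2`. Above it, `f x ≤ n` gives `E[f²] ≤ n E[f] < 2 E[f]²`. Below it,
  -- the excess `2 * S ^ 2` in `moment_ineq` is at most `n * c * S`, less than the available `(n +
  -- 1) * c * S`.
  rcases lt_or_ge (n * c) (2 * S) with h | h
  · calc c * Q ≤ c * (n * S) := mul_le_mul_of_nonneg_left hle hc.le
      _ = n * c * S := by ring
      _ < 2 * S * S := mul_lt_mul_of_pos_right h hS
      _ = 2 * S ^ 2 := by ring
  · have h' : 2 * S * S ≤ n * c * S := mul_le_mul_of_nonneg_right h hS.le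
    have h'' : 0 < c * S := mul_pos hc hS
    refine lt_of_mul_lt_mul_left (a := n + 1) ?_ (by positivity)
    linarith

end

/-! ### Asymptotic tightness from two disjoint chains. -/

section TwoChains
variable (a b : ℕ)

/-- A linear extension of two disjoint chains is determined by the positions of the first chain. -/
theorem restrict_left_bijective :
    Function.Bijective fun f : PosetLinExt (Fin a ⊕ Fin b) =>
      OrderEmbedding.ofStrictMono (fun i : Fin a => f.1 (Sum.inl i))
        fun _ _ h => f.2 (Sum.inl_strictMono h) := by
  constructor
  · intro f f' h
    have hl : ∀ i, f.1 (Sum.inl i) = f'.1 (Sum.inl i) := fun i => DFunLike.congr_fun h i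
    -- The second chain fills the complementary positions in increasing order, so it is forced.
    have hcompl : ∀ f : PosetLinExt (Fin a ⊕ Fin b),
        Set.range (fun j => f.1 (Sum.inr j)) = (Set.range fun i => f.1 (Sum.inl i))ᶜ := by
      intro f
      ext y
      obtain ⟨z | z, rfl⟩ := f.1.surjective y <;> simp
    have hr : (fun j => f.1 (Sum.inr j)) = fun j => f'.1 (Sum.inr j) :=
      (StrictMono.range_inj (fun _ _ h => f.2 (Sum.inr_strictMono h))
        (fun _ _ h => f'.2 (Sum.inr_strictMono h))).1 (by rw [hcompl, hcompl, funext hl])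
    exact Subtype.ext (Equiv.ext fun y => y.rec hl (congrFun hr))
  · intro e
    have h₁ : #(univ.map e.toEmbedding) = a := by simp
    have h₂ : #(univ.map e.toEmbedding)ᶜ = b := by
      rw [card_compl, h₁]
      simp
    refine ⟨⟨finSumEquivOfFinset h₁ h₂, ?_⟩, ?_⟩
    · rintro (i | i) (j | j) h
      · simpa using h
      · exact absurd h (by simp)
      · exact absurd h (by simp)
      · simpa using h
    · apply orderEmb_fin_ext
      have : ((univ.map e.toEmbedding).orderEmbOfFin h₁ : Fin a → _) = e :=
        congrArg DFunLike.coe (orderEmbOfFin_unique' h₁ (f := e) (by simp)).symm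
      simp [this]

theorem sum_two_chains (w : ℕ → ℕ) (i : Fin a) :
    ∑ f : PosetLinExt (Fin a ⊕ Fin b), w (f.1 (Sum.inl i)) =
      ∑ e : Fin a ↪o Fin (Fintype.card (Fin a ⊕ Fin b)), w (e i) :=
  Fintype.sum_bijective _ (restrict_left_bijective a b) _ _ fun _ => rfl

theorem secondMomentRatio_two_chains (a b n : ℕ) (hn : n = a + 1 + b) :
    secondMomentRatio (Sum.inl 0 : Fin (a + 1) ⊕ Fin b) =
      2 * (n + 2) * (a + 2) / ((a + 3) * (n + 1)) - (a + 2) / (n + 1) := by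
  have hcard : Fintype.card (Fin (a + 1) ⊕ Fin b) = n := by simp [hn]
  have h₀ := sum_two_chains (a + 1) b (fun _ => 1) 0
  have h₁ := (sum_two_chains (a + 1) b (fun t => t + 1) 0).trans (sum_orderEmb_succ 0)
  have h₂ := (sum_two_chains (a + 1) b (fun t => (t + 1) * (t + 2)) 0).trans
    (sum_orderEmb_succ_mul_succ 0)
  simp only [sum_const, card_univ, smul_eq_mul, mul_one, card_orderEmb_fin, hcard] at h₀
  have hS : ∑ f : PosetLinExt (Fin (a + 1) ⊕ Fin b), f.val (Sum.inl 0) =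
      (n + 1).choose (a + 2) := by
    rw [← hcard]
    have := congrArg (Nat.cast (R := ℝ)) h₁
    push_cast at this
    simpa [val] using this
  have hQ : ∑ f : PosetLinExt (Fin (a + 1) ⊕ Fin b), f.val (Sum.inl 0) ^ 2 =
      2 * (n + 2).choose (a + 3) - (n + 1).choose (a + 2) := by
    rw [← hS, eq_sub_iff_add_eq, ← sum_add_distrib, ← hcard]
    have := congrArg (Nat.cast (R := ℝ)) h₂
    push_cast at this
    simp only [Fin.val_zero, Nat.cast_zero, zero_add, one_mul] at this
    rw [← this]
    refine sum_congr rfl fun f _ => ?_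
    rw [val]
    ring
  have hc : (0 : ℝ) < n.choose (a + 1) := Nat.cast_pos.2 (Nat.choose_pos (by omega))
  have e₁ : ((n + 1).choose (a + 2) : ℝ) = (n + 1) * n.choose (a + 1) / (a + 2) := by
    rw [eq_div_iff (by positivity)]
    have := Nat.add_one_mul_choose_eq n (a + 1)
    have := congrArg (Nat.cast (R := ℝ)) this
    push_cast at this
    linarith
  have e₂ : ((n + 2).choose (a + 3) : ℝ) = (n + 2) * (n + 1).choose (a + 2) / (a + 3) := by
    rw [eq_div_iff (by positivity)]
    have := Nat.add_one_mul_choose_eq (n + 1) (a + 2)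
    have := congrArg (Nat.cast (R := ℝ)) this
    push_cast at this
    linarith
  rw [secondMomentRatio_eq, hS, hQ, h₀, e₂, e₁]
  field_simp

end TwoChains

theorem exists_secondMomentRatio_gt (ε : ℝ) (hε : 0 < ε) : ∃ N : ℕ, ∀ n : ℕ, N ≤ n →
    ∃ (X : Type) (_ : Fintype X) (_ : PartialOrder X) (x : X),
      Fintype.card X = n ∧ 2 - ε < secondMomentRatio x := by
  -- The first term of the ratio exceeds `2 * (a + 2) / (a + 3) = 2 - 2 / (a + 3)`, which is above
  -- `2 - ε / 2` for this `a`. With `a` fixed, the choice of `N` makes the subtracted term less than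
  -- `ε / 2`.
  obtain ⟨a, ha⟩ := exists_nat_gt (4 / ε)
  obtain ⟨N, hN⟩ := exists_nat_gt (2 * (a + 2) / ε)
  refine ⟨max N (a + 1), fun n hn => ?_⟩
  have hnN : (N : ℝ) ≤ n := Nat.cast_le.2 ((le_max_left _ _).trans hn)
  have han : a + 1 ≤ n := (le_max_right _ _).trans hn
  refine ⟨Fin (a + 1) ⊕ Fin (n - (a + 1)), inferInstance, inferInstance, Sum.inl 0, ?_, ?_⟩
  · simp [han]
  · rw [secondMomentRatio_two_chains a (n - (a + 1)) n (by omega)]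
    have h₁ : 2 - ε / 2 < 2 * (n + 2) * (a + 2) / ((a + 3) * (n + 1)) := by
      rw [div_lt_iff₀ hε] at ha
      rw [lt_div_iff₀ (by positivity)]
      have : 0 < (ε * a - 4) * (n + 1) := mul_pos (by linarith) (by positivity)
      have : 0 < ε * (n + 1) := by positivity
      nlinarith
    have h₂ : (a + 2) / ((n : ℝ) + 1) < ε / 2 := by
      rw [div_lt_iff₀ hε] at hN
      rw [div_lt_iff₀ (by positivity)]
      nlinarith
    linarith

end PosetLinExt

theorem corollaryc :
    (∀ (X : Type*) [Fintype X] [PartialOrder X] (x : X),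
      1 ≤ secondMomentRatio x ∧ secondMomentRatio x < 2) ∧
    (∀ ε : ℝ, 0 < ε → ∃ N : ℕ, ∀ n : ℕ, N ≤ n →
      ∃ (X : Type) (_ : Fintype X) (_ : PartialOrder X) (x : X),
        Fintype.card X = n ∧ 2 - ε < secondMomentRatio x) := by
  exact ⟨fun X _ _ x => ⟨PosetLinExt.one_le_secondMomentRatio x,
    PosetLinExt.secondMomentRatio_lt_two x⟩, PosetLinExt.exists_secondMomentRatio_gt⟩
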